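/- Let $G$ be a topological group and let $\mathcal N$ be a basis of neighbourhoods of the neutral element consisting of open subgroups of $G$. Let $L=\{VA: V\in\mathcal N,\ A\subseteq G\}$, which is a Boolean algebra of subsets of $G$. A set $A\subseteq G$ is syndetic if $g_1A\cup\dots\cup g_nA=G$ for some finitely many $g_1,\dots,g_n\in G$. A syndetic algebra is a Boolean algebra of subsets of $G$ that is invariant under left translations by elements of $G$ and all of whose nonempty elements are syndetic. A maximal syndetic subalgebra of $L$ is a syndetic algebra contained in $L$ that is maximal under inclusion among the syndetic algebras contained in $L$. The Stone space $\mathrm{ult}(\mathcal A)$ of a syndetic algebra $\mathcal A$ is the space of ultrafilters on $\mathcal A$, with the topology generated by the sets $\{u: A\in u\}$, $A\in\mathcal A$, and with the action $gu=\{gA:A\in u\}$ of $G$. A $G$-flow is a compact Hausdorff space with a continuous action of $G$; it is minimal if it is nonempty and every orbit is dense. A universal minimal flow of $G$ is a minimal $G$-flow $M(G)$ such that every minimal $G$-flow is the image of $M(G)$ under a continuous $G$-equivariant map. Then: 1. Maximal syndetic subalgebras of $L$ exist, and for every maximal syndetic subalgebra $\mathcal A$ of $L$ the Stone space $\mathrm{ult}(\mathcal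 A)$ is a universal minimal flow of $G$. Every universal minimal flow $M(G)$ of $G$ is isomorphic to $\mathrm{ult}(\mathcal A)$ as a $G$-flow (that is, by a $G$-equivariant homeomorphism). 2. Any two maximal syndetic subalgebras of $L$ are isomorphic, by an isomorphism of Boolean algebras that commutes with the left translations by elements of $G$. 3. Consequently, every universal minimal flow $M(G)$ of $G$ is totally disconnected. -/

import Mathlib

universe u v w

open Topology
open scoped Pointwise

namespace FlowStone

/-! ### Flows and universal minimal flows -/

/-- `X` with the given action of the topological group `G` is a `G`-flow: `X` is compact
Hausdorff and the action `G × X → X` is jointly continuous. -/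
structure IsFlow (G X : Type*) [Group G] [TopologicalSpace G] [TopologicalSpace X]
    [MulAction G X] : Prop where
  compact : CompactSpace X
  hausdorff : T2Space X
  continuous_smul : ContinuousSMul G X

/-- A minimal `G`-flow: a nonempty flow in which every orbit is dense (equivalently, without
proper nonempty closed invariant subsets). -/
structure IsMinimalFlow (G X : Type*) [Group G] [TopologicalSpace G] [TopologicalSpace X]
    [MulAction G X] : Prop extends IsFlow G X where
  nonempty : Nonempty X
  minimal : MulAction.IsMinimal G X


/-- `M` is a universal minimal flow of `G`: a minimal flow that has every minimal flow (on a type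
in `Type w`) as a factor, i.e. as image under a continuous equivariant map. -/
structure IsUniversalMinimalFlow (G : Type u) (M : Type v) [Group G] [TopologicalSpace G]
    [TopologicalSpace M] [MulAction G M] : Prop extends IsMinimalFlow G M where
  universal : ∀ (X : Type w) [TopologicalSpace X] [MulAction G X], IsMinimalFlow G X →
    ∃ φ : M →[G] X, Continuous φ ∧ Function.Surjective φ

/-- Two `G`-flows are isomorphic: there is an equivariant homeomorphism between them. -/
def FlowIso (G : Type*) (X Y : Type*) [Group G] [TopologicalSpace X] [MulAction G X]
    [TopologicalSpace Y] [MulAction G Y] : Prop :=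
  ∃ e : X ≃ₜ Y, ∀ (g : G) (x : X), e (g • x) = g • e x

/-! ### The Stone space of a Boolean algebra -/

/-- An ultrafilter on a Boolean algebra `B`. -/
@[ext]
structure BoolUltrafilter (B : Type*) [BooleanAlgebra B] where
  carrier : Set B
  top_mem : ⊤ ∈ carrier
  bot_notMem : ⊥ ∉ carrier
  inf_mem : ∀ a ∈ carrier, ∀ b ∈ carrier, a ⊓ b ∈ carrier
  mem_of_le : ∀ a ∈ carrier, ∀ b, a ≤ b → b ∈ carrier
  mem_or_compl_mem : ∀ a, a ∈ carrier ∨ aᶜ ∈ carrier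

/-- The Stone topology, generated by the sets of all ultrafilters containing a given element. -/
instance BoolUltrafilter.instTopologicalSpace (B : Type*) [BooleanAlgebra B] :
    TopologicalSpace (BoolUltrafilter B) :=
  TopologicalSpace.generateFrom
    (Set.range fun a : B => {u : BoolUltrafilter B | a ∈ u.carrier})

/-! ### Algebras of subsets of a group -/

/-- `A ⊆ G` is syndetic if finitely many left translates of `A` cover `G`. -/
def IsSyndetic {G : Type*} [Group G] (A : Set G) : Prop :=
  ∃ F : Finset G, ⋃ g ∈ F, g • A = Set.univ

/-- A syndetic algebra on `G`: a Boolean algebra of subsets of `G` (with the set operations) that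
is invariant under left translations and whose nonempty elements are all syndetic. -/
structure SyndeticAlgebra (G : Type*) [Group G] extends BooleanSubalgebra (Set G) where
  smul_mem' : ∀ (g : G) (A : Set G), A ∈ carrier → g • A ∈ carrier
  syndetic' : ∀ A : Set G, A ∈ carrier → A.Nonempty → IsSyndetic A

namespace SyndeticAlgebra

variable {G : Type*} [Group G]

theorem toBooleanSubalgebra_injective :
    Function.Injective (toBooleanSubalgebra : SyndeticAlgebra G → BooleanSubalgebra (Set G)) := by
  rintro ⟨a, _, _⟩ ⟨b, _, _⟩ h
  cases h
  rfl

/-- Syndetic algebras are ordered by inclusion. -/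
instance : PartialOrder (SyndeticAlgebra G) :=
  PartialOrder.lift toBooleanSubalgebra toBooleanSubalgebra_injective

/-- `G` acts on a syndetic algebra by left translations. -/
instance (𝒜 : SyndeticAlgebra G) : MulAction G 𝒜.toBooleanSubalgebra where
  smul g A := ⟨g • (A : Set G), 𝒜.smul_mem' g A A.2⟩
  one_smul A := Subtype.ext (one_smul G (A : Set G))
  mul_smul g h A := Subtype.ext (mul_smul g h (A : Set G))

theorem coe_smul (𝒜 : SyndeticAlgebra G) (g : G) (A : 𝒜.toBooleanSubalgebra) :
    ((g • A : 𝒜.toBooleanSubalgebra) : Set G) = g • (A : Set G) := rfl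

/-- The Stone space of a syndetic algebra. -/
abbrev StoneSpace (𝒜 : SyndeticAlgebra G) : Type _ := BoolUltrafilter 𝒜.toBooleanSubalgebra

/-- The action of `G` on the Stone space: `g • u = {g • A : A ∈ u}`. -/
instance (𝒜 : SyndeticAlgebra G) : MulAction G 𝒜.StoneSpace where
  smul g u :=
    { carrier := (fun A => g • A) '' u.carrier
      top_mem := ⟨⊤, u.top_mem, Subtype.ext Set.smul_set_univ⟩
      bot_notMem := by
        rintro ⟨A, hA, h⟩
        have h0 : A = ⊥ := by
          apply Subtype.ext
          have h1 : g • (A : Set G) = ∅ := congrArg Subtype.val h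
          exact Set.smul_set_eq_empty.1 h1
        exact u.bot_notMem (h0 ▸ hA)
      inf_mem := by
        rintro _ ⟨A, hA, rfl⟩ _ ⟨B, hB, rfl⟩
        exact ⟨A ⊓ B, u.inf_mem A hA B hB, Subtype.ext Set.smul_set_inter⟩
      mem_of_le := by
        rintro _ ⟨A, hA, rfl⟩ B h
        refine ⟨g⁻¹ • B, u.mem_of_le A hA _ ?_, smul_inv_smul g B⟩
        have h1 : g • (A : Set G) ⊆ (B : Set G) := h
        exact Set.smul_set_subset_iff_subset_inv_smul_set.1 h1
      mem_or_compl_mem := by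
        intro A
        rcases u.mem_or_compl_mem (g⁻¹ • A) with h | h
        · exact Or.inl ⟨_, h, smul_inv_smul g A⟩
        · refine Or.inr ⟨_, h, Subtype.ext ?_⟩
          change g • (g⁻¹ • (A : Set G))ᶜ = (A : Set G)ᶜ
          rw [Set.smul_set_compl, smul_inv_smul] }
  one_smul u := by
    apply BoolUltrafilter.ext
    change (fun A => (1 : G) • A) '' u.carrier = u.carrier
    simp
  mul_smul g h u := by
    apply BoolUltrafilter.ext
    change (fun A => (g * h) • A) '' u.carrier = (fun A => g • A) '' ((fun A => h • A) '' u.carrier)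
    rw [Set.image_image]
    simp only [mul_smul]

/-- Two syndetic algebras are isomorphic: there is an isomorphism of Boolean algebras between them
that commutes with left translations. (An order isomorphism between Boolean algebras preserves
all Boolean operations.) -/
def Isomorphic (𝒜 ℬ : SyndeticAlgebra G) : Prop :=
  ∃ e : 𝒜.toBooleanSubalgebra ≃o ℬ.toBooleanSubalgebra,
    ∀ (g : G) (A : 𝒜.toBooleanSubalgebra), e (g • A) = g • e A

/-- `𝒜` is a maximal syndetic subalgebra of the algebra `L`: it is contained in `L`, and no
syndetic algebra contained in `L` is strictly larger. -/
def IsMaximalIn (L : BooleanSubalgebra (Set G)) (𝒜 : SyndeticAlgebra G) : Prop :=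
  Maximal (fun ℬ : SyndeticAlgebra G => ℬ.toBooleanSubalgebra ≤ L) 𝒜

end SyndeticAlgebra

section AlgebraL

theorem mul_subset_iff_exists {G : Type*} [Group G] {V : Subgroup G} {S : Set G} :
    (V : Set G) * S ⊆ S ↔ ∃ A : Set G, S = (V : Set G) * A := by
  constructor
  · intro h
    exact ⟨S, Set.Subset.antisymm (fun x hx => ⟨1, V.one_mem, x, hx, one_mul x⟩) h⟩
  · rintro ⟨A, rfl⟩
    rw [← mul_assoc, coe_mul_coe]

variable {G : Type*} [Group G] [TopologicalSpace G]

/-- The Boolean algebra `L = {VA : V ∈ N, A ⊆ G}` of subsets of `G`, where `N` is a basis of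
neighbourhoods of the neutral element that consists of open subgroups. -/
def algebraL (N : Set (OpenSubgroup G))
    (hN : (𝓝 (1 : G)).HasBasis (fun V : OpenSubgroup G => V ∈ N) (fun V => (V : Set G))) :
    BooleanSubalgebra (Set G) where
  carrier := {S | ∃ V ∈ N, ∃ A : Set G, S = (V : Set G) * A}
  supClosed' := by
    rintro S ⟨V, hV, hS⟩ T ⟨W, hW, hT⟩
    obtain ⟨U, hU, hUVW⟩ := hN.mem_iff.1
      (Filter.inter_mem (hN.mem_of_mem hV) (hN.mem_of_mem hW))
    have hS' := (mul_subset_iff_exists (V := V.toSubgroup)).2 hS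
    have hT' := (mul_subset_iff_exists (V := W.toSubgroup)).2 hT
    refine ⟨U, hU, (mul_subset_iff_exists (V := U.toSubgroup)).1 ?_⟩
    rintro _ ⟨g, hg, x, hx | hx, rfl⟩
    · exact Or.inl (hS' ⟨g, (hUVW hg).1, x, hx, rfl⟩)
    · exact Or.inr (hT' ⟨g, (hUVW hg).2, x, hx, rfl⟩)
  infClosed' := by
    rintro S ⟨V, hV, hS⟩ T ⟨W, hW, hT⟩
    obtain ⟨U, hU, hUVW⟩ := hN.mem_iff.1
      (Filter.inter_mem (hN.mem_of_mem hV) (hN.mem_of_mem hW))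
    have hS' := (mul_subset_iff_exists (V := V.toSubgroup)).2 hS
    have hT' := (mul_subset_iff_exists (V := W.toSubgroup)).2 hT
    refine ⟨U, hU, (mul_subset_iff_exists (V := U.toSubgroup)).1 ?_⟩
    rintro _ ⟨g, hg, x, hx, rfl⟩
    exact ⟨hS' ⟨g, (hUVW hg).1, x, hx.1, rfl⟩, hT' ⟨g, (hUVW hg).2, x, hx.2, rfl⟩⟩
  compl_mem' := by
    rintro S ⟨V, hV, hS⟩
    have hS' := (mul_subset_iff_exists (V := V.toSubgroup)).2 hS
    refine ⟨V, hV, (mul_subset_iff_exists (V := V.toSubgroup)).1 ?_⟩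
    rintro _ ⟨g, hg, x, hx, rfl⟩ h
    exact hx (hS' ⟨g⁻¹, inv_mem hg, g * x, h, inv_mul_cancel_left g x⟩)
  bot_mem' := by
    obtain ⟨V, hV, _⟩ := hN.mem_iff.1 Filter.univ_mem
    exact ⟨V, hV, ∅, (Set.mul_empty).symm⟩

end AlgebraL

end FlowStone

namespace FlowStone

open Filter

/-! ### Return sets of ultrafilters on a group -/

section ReturnSet

variable {G : Type*} [Group G]

/-! Fix a minimal closed translation-invariant set `M` of ultrafilters on the discrete group `G`.
For `p ∈ M` the map `A ↦ returnSet p A` is a Boolean homomorphism commuting with left translations.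
By minimality its kernel does not depend on `p` (`returnSet_eq_empty`), and by compactness its
nonempty values are syndetic (`isSyndetic_returnSet`). So the image of `L` is a syndetic algebra
`returnAlgebra`, again inside `L`.

Maximal syndetic subalgebras exist by Zorn. Each one is a `returnAlgebra`: some `p ∈ M` has the same
trace on it as the principal ultrafilter at `1`, and then `returnSet p` fixes all its elements.
Since the kernels agree, any two maximal algebras are isomorphic.

For universality, take a point `x₀` of a minimal flow and put `y = lim_{k → p} k • x₀`. The map `q ↦
lim_{h → q} h • y` depends only on the trace of `q` on the algebra
(`extend_smul_eq_of_restrict_eq`), so it descends to the Stone space. Uniqueness is a coalescence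
argument: equivariant continuous self-maps of the Stone space are injective
(`IsMaximalIn.injective_of_equivariant`), hence so is every factor map onto a universal minimal
flow. -/

/-- The translate of an ultrafilter on `G` by an element of `G`. -/
def translate (g : G) (q : Ultrafilter G) : Ultrafilter G := q.map (g • ·)

theorem mem_translate {g : G} {q : Ultrafilter G} {A : Set G} :
    A ∈ translate g q ↔ g⁻¹ • A ∈ q := by
  rw [translate, Ultrafilter.mem_map, Set.preimage_smul]

/-- The set of all `h` such that the translate of `p` by `h` contains `A`. -/
def returnSet (p : Ultrafilter G) (A : Set G) : Set G := {h | h⁻¹ • A ∈ p}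

theorem mem_returnSet {p : Ultrafilter G} {A : Set G} {h : G} :
    h ∈ returnSet p A ↔ h⁻¹ • A ∈ p := Iff.rfl

theorem returnSet_inter (p : Ultrafilter G) (A B : Set G) :
    returnSet p (A ∩ B) = returnSet p A ∩ returnSet p B := by
  ext h
  simp only [mem_returnSet, Set.smul_set_inter, Set.mem_inter_iff]
  exact inter_mem_iff

theorem returnSet_union (p : Ultrafilter G) (A B : Set G) :
    returnSet p (A ∪ B) = returnSet p A ∪ returnSet p B := by
  ext h
  simp only [mem_returnSet, Set.smul_set_union, Set.mem_union]
  exact Ultrafilter.union_mem_iff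

theorem returnSet_compl (p : Ultrafilter G) (A : Set G) :
    returnSet p Aᶜ = (returnSet p A)ᶜ := by
  ext h
  simp only [mem_returnSet, Set.smul_set_compl, Set.mem_compl_iff]
  exact Ultrafilter.compl_mem_iff_notMem

theorem returnSet_empty (p : Ultrafilter G) : returnSet p ∅ = ∅ := by
  ext h
  simp [mem_returnSet]

theorem returnSet_smul (p : Ultrafilter G) (g : G) (A : Set G) :
    returnSet p (g • A) = g • returnSet p A := by
  ext h
  rw [Set.mem_smul_set_iff_inv_smul_mem, mem_returnSet, mem_returnSet, smul_smul, smul_eq_mul,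
    mul_inv_rev, inv_inv]

theorem returnSet_translate (p : Ultrafilter G) (g : G) (A : Set G) :
    returnSet (translate g p) A = {h | h * g ∈ returnSet p A} := by
  ext h
  simp [mem_returnSet, mem_translate, smul_smul]

theorem returnSet_subset_iff (p : Ultrafilter G) (A B : Set G) :
    returnSet p A ⊆ returnSet p B ↔ returnSet p (A ∩ Bᶜ) = ∅ := by
  rw [returnSet_inter, returnSet_compl, ← Set.disjoint_iff_inter_eq_empty,
    Set.disjoint_compl_right_iff_subset]

/-- A minimal closed translation-invariant set of ultrafilters on `G`. -/
structure IsMinimalInvariant (M : Set (Ultrafilter G)) : Prop where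
  isClosed : IsClosed M
  nonempty : M.Nonempty
  translate_mem : ∀ g : G, ∀ q ∈ M, translate g q ∈ M
  eq_of_subset : ∀ M' ⊆ M, IsClosed M' → M'.Nonempty → (∀ g : G, ∀ q ∈ M', translate g q ∈ M') →
    M' = M

variable (G) in
theorem exists_isMinimalInvariant : ∃ M : Set (Ultrafilter G), IsMinimalInvariant M := by
  let S : Set (Set (Ultrafilter G)) :=
    {M | IsClosed M ∧ M.Nonempty ∧ ∀ g : G, ∀ q ∈ M, translate g q ∈ M}
  have hS : ∀ c ⊆ S, IsChain (· ⊆ ·) c → c.Nonempty → ∃ lb ∈ S, ∀ s ∈ c, lb ⊆ s := by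
    intro c hc hchain hne
    refine ⟨⋂₀ c, ⟨isClosed_sInter fun s hs => (hc hs).1, ?_, fun g q hq s hs =>
      (hc hs).2.2 g q (hq s hs)⟩, fun s hs => Set.sInter_subset_of_mem hs⟩
    have : Nonempty c := hne.to_subtype
    exact IsCompact.nonempty_sInter_of_directed_nonempty_isCompact_isClosed
      (show IsChain (· ⊇ ·) c from hchain.symm).directedOn (fun s hs => (hc hs).2.1)
      (fun s hs => (hc hs).1.isCompact)
      (fun s hs => (hc hs).1)
  obtain ⟨M, -, hM⟩ := zorn_superset_nonempty S hS Set.univ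
    ⟨isClosed_univ, ⟨pure 1, trivial⟩, fun _ _ _ => trivial⟩
  exact ⟨M, hM.prop.1, hM.prop.2.1, hM.prop.2.2,
    fun M' hM' h1 h2 h3 => hM.eq_of_subset ⟨h1, h2, h3⟩ hM'⟩

namespace IsMinimalInvariant

variable {M : Set (Ultrafilter G)} (hM : IsMinimalInvariant M)
include hM

/-- The members of `M` whose return set to `A` is empty form a closed invariant subset, which is all
of `M` once it contains one point. -/
theorem returnSet_eq_empty {p q : Ultrafilter G} (hp : p ∈ M) (hq : q ∈ M) {A : Set G}
    (h : returnSet p A = ∅) : returnSet q A = ∅ := by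
  have key : {r ∈ M | returnSet r A = ∅} = M := by
    refine hM.eq_of_subset _ (Set.sep_subset _ _) ?_ ⟨p, hp, h⟩ ?_
    · have : {r ∈ M | returnSet r A = ∅} = M ∩ ⋂ g : G, {r | g⁻¹ • A ∈ r}ᶜ := by
        ext r
        simp [Set.eq_empty_iff_forall_notMem, mem_returnSet]
      rw [this]
      exact hM.isClosed.inter
        (isClosed_iInter fun g => (ultrafilter_isOpen_basic _).isClosed_compl)
    · rintro g r ⟨hr, h0⟩
      refine ⟨hM.translate_mem g r hr, ?_⟩
      rw [returnSet_translate, h0]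
      rfl
  rw [← key] at hq
  exact hq.2

theorem returnSet_subset_iff {p q : Ultrafilter G} (hp : p ∈ M) (hq : q ∈ M) (A B : Set G) :
    returnSet p A ⊆ returnSet p B ↔ returnSet q A ⊆ returnSet q B := by
  rw [FlowStone.returnSet_subset_iff, FlowStone.returnSet_subset_iff]
  exact ⟨hM.returnSet_eq_empty hp hq, hM.returnSet_eq_empty hq hp⟩

/-- A point of `M` outside every set `{q | g • A ∈ q}` would have an empty return set, so these open
sets cover `M`. A finite subcover, evaluated at the translates of `p`, gives the translates that
cover `G`. -/
theorem isSyndetic_returnSet {p : Ultrafilter G} (hp : p ∈ M) {A : Set G}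
    (h : (returnSet p A).Nonempty) : IsSyndetic (returnSet p A) := by
  obtain ⟨F, hF⟩ := hM.isClosed.isCompact.elim_finite_subcover
    (fun g : G => {q : Ultrafilter G | g • A ∈ q}) (fun g => ultrafilter_isOpen_basic _) (by
      intro q hq
      by_contra hcon
      refine h.ne_empty (hM.returnSet_eq_empty hq hp (Set.eq_empty_of_forall_notMem fun g hg => ?_))
      exact hcon (Set.mem_iUnion.2 ⟨g⁻¹, hg⟩))
  refine ⟨F, Set.eq_univ_of_forall fun k => ?_⟩
  obtain ⟨g, hgF, hg⟩ := Set.mem_iUnion₂.1 (hF (hM.translate_mem k p hp))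
  refine Set.mem_iUnion₂.2 ⟨g, hgF, ?_⟩
  rw [← returnSet_smul]
  exact mem_translate.1 hg

end IsMinimalInvariant

end ReturnSet

/-! ### The Stone space of a Boolean algebra of sets -/

namespace BoolUltrafilter

variable {B : Type*} [BooleanAlgebra B]

theorem isOpen_setOf_mem (a : B) : IsOpen {u : BoolUltrafilter B | a ∈ u.carrier} :=
  TopologicalSpace.isOpen_generateFrom_of_mem ⟨a, rfl⟩

theorem inf_mem_iff (u : BoolUltrafilter B) {a b : B} :
    a ⊓ b ∈ u.carrier ↔ a ∈ u.carrier ∧ b ∈ u.carrier :=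
  ⟨fun h => ⟨u.mem_of_le _ h _ inf_le_left, u.mem_of_le _ h _ inf_le_right⟩,
    fun h => u.inf_mem _ h.1 _ h.2⟩

theorem compl_mem_iff (u : BoolUltrafilter B) {a : B} : aᶜ ∈ u.carrier ↔ a ∉ u.carrier :=
  ⟨fun h h' => u.bot_notMem (inf_compl_eq_bot (a := a) ▸ u.inf_mem _ h' _ h),
    (u.mem_or_compl_mem a).resolve_left⟩

theorem sup_mem_iff (u : BoolUltrafilter B) {a b : B} :
    a ⊔ b ∈ u.carrier ↔ a ∈ u.carrier ∨ b ∈ u.carrier := by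
  rw [← not_iff_not, ← compl_mem_iff, compl_sup, inf_mem_iff, compl_mem_iff, compl_mem_iff, not_or]

theorem isClopen_setOf_mem (a : B) : IsClopen {u : BoolUltrafilter B | a ∈ u.carrier} := by
  refine ⟨⟨?_⟩, isOpen_setOf_mem a⟩
  convert isOpen_setOf_mem aᶜ using 1
  ext u
  exact u.compl_mem_iff.symm

theorem exists_mem_notMem {u v : BoolUltrafilter B} (h : u ≠ v) :
    ∃ a ∈ u.carrier, a ∉ v.carrier := by
  by_contra! hcon
  refine h (BoolUltrafilter.ext (Set.Subset.antisymm hcon fun a ha => ?_))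
  by_contra hau
  exact v.compl_mem_iff.1 (hcon _ (u.compl_mem_iff.2 hau)) ha

instance : TotallySeparatedSpace (BoolUltrafilter B) where
  isTotallySeparated_univ u _ v _ h := by
    obtain ⟨a, hu, hv⟩ := exists_mem_notMem h
    exact ⟨_, _, isOpen_setOf_mem a, (isClopen_setOf_mem a).compl.isOpen, hu, hv,
      fun w _ => em _, disjoint_compl_right⟩

theorem isTopologicalBasis : TopologicalSpace.IsTopologicalBasis
    (Set.range fun a : B => {u : BoolUltrafilter B | a ∈ u.carrier}) where
  exists_subset_inter := by
    rintro _ ⟨a, rfl⟩ _ ⟨b, rfl⟩ u hu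
    exact ⟨_, ⟨a ⊓ b, rfl⟩, u.inf_mem_iff.2 hu, fun v hv => v.inf_mem_iff.1 hv⟩
  sUnion_eq := Set.eq_univ_of_forall fun u => ⟨_, ⟨⊤, rfl⟩, u.top_mem⟩
  eq_generateFrom := rfl

theorem exists_eq_setOf_mem [CompactSpace (BoolUltrafilter B)] {U : Set (BoolUltrafilter B)}
    (hU : IsClopen U) : ∃ a : B, U = {u | a ∈ u.carrier} := by
  -- Compactness induction: the property of `s` is that one basic set fits between `s` and `U`. At
  -- `s = U` this is equality.
  refine (hU.isClosed.isCompact.induction_on (p := fun s => ∃ a : B,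
    s ⊆ {u | a ∈ u.carrier} ∧ {u : BoolUltrafilter B | a ∈ u.carrier} ⊆ U) ?_ ?_ ?_ ?_).imp
    fun a h => h.1.antisymm h.2
  · exact ⟨⊥, Set.empty_subset _, fun u hu => (u.bot_notMem hu).elim⟩
  · rintro s t hst ⟨a, h, h'⟩
    exact ⟨a, hst.trans h, h'⟩
  · rintro s t ⟨a, ha, ha'⟩ ⟨b, hb, hb'⟩
    refine ⟨a ⊔ b, ?_, fun u hu => (u.sup_mem_iff.1 hu).elim (@ha' u) (@hb' u)⟩
    rintro u (hu | hu)
    · exact u.sup_mem_iff.2 (Or.inl (ha hu))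
    · exact u.sup_mem_iff.2 (Or.inr (hb hu))
  · intro u hu
    obtain ⟨_, ⟨a, rfl⟩, hau, haU⟩ := isTopologicalBasis.exists_subset_of_mem_open hu hU.isOpen
    exact ⟨_, mem_nhdsWithin_of_mem_nhds ((isOpen_setOf_mem a).mem_nhds hau), a, subset_rfl, haU⟩

end BoolUltrafilter

section Restrict

variable {G : Type*} (B : BooleanSubalgebra (Set G))

/-- The trace of an ultrafilter on `G` on a Boolean algebra of subsets of `G`. -/
def restrict (q : Ultrafilter G) : BoolUltrafilter B where
  carrier := {A | (A : Set G) ∈ q}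
  top_mem := univ_mem
  bot_notMem := q.empty_notMem
  inf_mem _ ha _ hb := inter_mem ha hb
  mem_of_le _ ha _ hab := mem_of_superset ha hab
  mem_or_compl_mem A := q.mem_or_compl_mem A

variable {B}

theorem mem_restrict {q : Ultrafilter G} {A : B} : A ∈ (restrict B q).carrier ↔ (A : Set G) ∈ q :=
  Iff.rfl

variable (B)

theorem continuous_restrict : Continuous (restrict B) := by
  refine continuous_generateFrom_iff.2 ?_
  rintro _ ⟨A, rfl⟩
  exact ultrafilter_isOpen_basic (A : Set G)

/-- The upward closure of `u` in the power set is a proper filter; an ultrafilter refining it has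
trace containing `u`, hence equal to `u`. -/
theorem restrict_surjective : Function.Surjective (restrict B) := by
  intro u
  let F : Filter G :=
    { sets := {S | ∃ A ∈ u.carrier, (A : Set G) ⊆ S}
      univ_sets := ⟨⊤, u.top_mem, Set.subset_univ _⟩
      sets_of_superset := fun ⟨A, hA, h⟩ h' => ⟨A, hA, h.trans h'⟩
      inter_sets := fun ⟨A, hA, h⟩ ⟨A', hA', h'⟩ =>
        ⟨A ⊓ A', u.inf_mem _ hA _ hA', Set.inter_subset_inter h h'⟩ }
  have hF : F.NeBot := by
    refine ⟨fun h => ?_⟩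
    obtain ⟨A, hA, h0⟩ : ∅ ∈ F := h ▸ mem_bot
    have : A = ⊥ := Subtype.ext (Set.subset_empty_iff.1 h0)
    exact u.bot_notMem (this ▸ hA)
  have hle : ∀ A ∈ u.carrier, (A : Set G) ∈ Ultrafilter.of F :=
    fun A hA => Ultrafilter.of_le F ⟨A, hA, subset_rfl⟩
  refine ⟨Ultrafilter.of F, BoolUltrafilter.ext (Set.Subset.antisymm (fun A hA => ?_) hle)⟩
  by_contra hcon
  exact Ultrafilter.compl_mem_iff_notMem.1 (hle _ (u.compl_mem_iff.2 hcon)) hA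

instance : CompactSpace (BoolUltrafilter B) :=
  (restrict_surjective B).compactSpace (continuous_restrict B)

theorem isQuotientMap_restrict : IsQuotientMap (restrict B) :=
  (continuous_restrict B).isClosedMap.isQuotientMap (continuous_restrict B) (restrict_surjective B)

end Restrict

/-! ### The algebra `L` -/

section MemL

variable {G : Type*} [Group G] [TopologicalSpace G] {N : Set (OpenSubgroup G)}
  (hN : (𝓝 (1 : G)).HasBasis (fun V : OpenSubgroup G => V ∈ N) (fun V => (V : Set G)))

/-- A description of `L` without the basis: its elements are the sets whose left stabiliser is a
neighbourhood of `1`. -/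
theorem mem_algebraL_iff {S : Set G} : S ∈ algebraL N hN ↔ ∀ᶠ g in 𝓝 (1 : G), g • S = S := by
  constructor
  · rintro ⟨V, hV, A, rfl⟩
    filter_upwards [hN.mem_of_mem hV] with g hg
    rw [← smul_mul_assoc, smul_coe_set (show g ∈ V from hg)]
  · intro h
    obtain ⟨V, hV, hVS⟩ := hN.mem_iff.1 h
    refine ⟨V, hV, (mul_subset_iff_exists (V := V.toSubgroup)).1 ?_⟩
    rintro _ ⟨g, hg, x, hx, rfl⟩
    exact (show g • S = S from hVS hg).subset (Set.smul_mem_smul_set hx)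

/-- This local constancy of `g ↦ g⁻¹ • S` is what makes the action on the Stone space jointly
continuous. -/
theorem eventually_inv_smul_eq [IsTopologicalGroup G] {S : Set G} (hS : S ∈ algebraL N hN)
    (g₀ : G) : ∀ᶠ g in 𝓝 g₀, g⁻¹ • S = g₀⁻¹ • S := by
  have h : Tendsto (fun g : G => g₀ * g⁻¹) (𝓝 g₀) (𝓝 1) := by
    have : Continuous fun g : G => g₀ * g⁻¹ := by fun_prop
    simpa using this.tendsto g₀
  filter_upwards [h.eventually ((mem_algebraL_iff hN).1 hS)] with g hg
  rw [eq_inv_smul_iff, smul_smul, hg]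

theorem smul_mem_algebraL [IsTopologicalGroup G] {S : Set G} (hS : S ∈ algebraL N hN) (g : G) :
    g • S ∈ algebraL N hN := by
  rw [mem_algebraL_iff]
  have h : Tendsto (fun h : G => g⁻¹ * h * g) (𝓝 1) (𝓝 1) := by
    have : Continuous fun h : G => g⁻¹ * h * g := by fun_prop
    simpa using this.tendsto 1
  filter_upwards [h.eventually ((mem_algebraL_iff hN).1 hS)] with k hk
  rw [mul_assoc, mul_smul, inv_smul_eq_iff, mul_smul] at hk
  exact hk

/-- Taking return sets commutes with left translation, so whatever stabilises `S` stabilises its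
return set. -/
theorem returnSet_mem_algebraL {S : Set G} (hS : S ∈ algebraL N hN) (p : Ultrafilter G) :
    returnSet p S ∈ algebraL N hN := by
  rw [mem_algebraL_iff] at hS ⊢
  filter_upwards [hS] with g hg
  rw [← returnSet_smul, hg]

end MemL

variable {G : Type*} [Group G]

/-! ### The Stone space of a syndetic algebra as a flow -/

namespace SyndeticAlgebra

theorem mem_smul_iff {𝒜 : SyndeticAlgebra G} {g : G} {u : 𝒜.StoneSpace}
    {A : 𝒜.toBooleanSubalgebra} : A ∈ (g • u).carrier ↔ g⁻¹ • A ∈ u.carrier := by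
  constructor
  · rintro ⟨B, hB, rfl⟩
    rwa [inv_smul_smul]
  · exact fun h => ⟨_, h, smul_inv_smul g A⟩

theorem restrict_translate (𝒜 : SyndeticAlgebra G) (g : G) (q : Ultrafilter G) :
    restrict 𝒜.toBooleanSubalgebra (translate g q)
      = (g • restrict 𝒜.toBooleanSubalgebra q : 𝒜.StoneSpace) := by
  apply BoolUltrafilter.ext
  ext A
  rw [mem_smul_iff, mem_restrict, mem_restrict, mem_translate, coe_smul]

theorem mem_smul_restrict_pure_one {𝒜 : SyndeticAlgebra G} {g : G} {A : 𝒜.toBooleanSubalgebra} :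
    A ∈ (g • restrict 𝒜.toBooleanSubalgebra (pure 1) : 𝒜.StoneSpace).carrier ↔ g ∈ (A : Set G) := by
  rw [mem_smul_iff, mem_restrict, coe_smul, Ultrafilter.mem_pure,
    Set.mem_inv_smul_set_iff, smul_eq_mul, mul_one]

theorem mem_smul_restrict {𝒜 : SyndeticAlgebra G} {g : G} {q : Ultrafilter G}
    {A : 𝒜.toBooleanSubalgebra} :
    A ∈ (g • restrict 𝒜.toBooleanSubalgebra q : 𝒜.StoneSpace).carrier ↔
      g ∈ returnSet q (A : Set G) := by
  rw [mem_smul_iff, mem_restrict, coe_smul, mem_returnSet]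

theorem exists_smul_mem (𝒜 : SyndeticAlgebra G) (u : 𝒜.StoneSpace) {A : 𝒜.toBooleanSubalgebra}
    (hA : A ≠ ⊥) : ∃ g : G, A ∈ (g • u).carrier := by
  obtain ⟨F, hF⟩ := 𝒜.syndetic' A A.2
    (Set.nonempty_iff_ne_empty.2 fun h => hA (Subtype.ext h))
  obtain ⟨q, rfl⟩ := restrict_surjective _ u
  have h : ⋃ g ∈ F, g • (A : Set G) ∈ q := hF ▸ univ_mem
  obtain ⟨g, -, hg⟩ := (Ultrafilter.finite_biUnion_mem_iff F.finite_toSet).1 h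
  refine ⟨g⁻¹, mem_smul_restrict.2 ?_⟩
  rwa [mem_returnSet, inv_inv]

instance (𝒜 : SyndeticAlgebra G) : MulAction.IsMinimal G 𝒜.StoneSpace where
  dense_orbit u := by
    refine BoolUltrafilter.isTopologicalBasis.dense_iff.2 ?_
    rintro _ ⟨A, rfl⟩ ⟨v, hv⟩
    obtain ⟨g, hg⟩ := 𝒜.exists_smul_mem u (A := A) (fun h => v.bot_notMem (h ▸ hv))
    exact ⟨g • u, hg, g, rfl⟩

theorem isMinimalFlow [TopologicalSpace G] [IsTopologicalGroup G] {N : Set (OpenSubgroup G)}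
    (hN : (𝓝 (1 : G)).HasBasis (fun V : OpenSubgroup G => V ∈ N) (fun V => (V : Set G)))
    {𝒜 : SyndeticAlgebra G} (h𝒜 : 𝒜.toBooleanSubalgebra ≤ algebraL N hN) :
    IsMinimalFlow G 𝒜.StoneSpace where
  compact := inferInstance
  hausdorff := inferInstance
  continuous_smul := by
    refine ⟨continuous_generateFrom_iff.2 ?_⟩
    rintro _ ⟨A, rfl⟩
    refine isOpen_iff_mem_nhds.2 ?_
    rintro ⟨g₀, u₀⟩ hmem
    filter_upwards [prod_mem_nhds (eventually_inv_smul_eq hN (h𝒜 A.2) g₀)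
      ((BoolUltrafilter.isOpen_setOf_mem (g₀⁻¹ • A)).mem_nhds (mem_smul_iff.1 hmem))]
    rintro ⟨g, u⟩ ⟨hg, hu⟩
    have hgA : g⁻¹ • A = g₀⁻¹ • A := Subtype.ext hg
    exact mem_smul_iff.2 (hgA ▸ hu)
  nonempty := ⟨restrict _ (pure 1)⟩
  minimal := inferInstance

end SyndeticAlgebra

theorem surjective_of_equivariant {X Y : Type*} [TopologicalSpace X] [TopologicalSpace Y]
    [MulAction G X] [MulAction G Y] [CompactSpace X] [Nonempty X] [T2Space Y]
    [MulAction.IsMinimal G Y] {f : X → Y} (hf : Continuous f)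
    (hsmul : ∀ (g : G) (x : X), f (g • x) = g • f x) : Function.Surjective f := by
  rw [← Set.range_eq_univ]
  refine (eq_empty_or_univ_of_smul_invariant_closed G (isCompact_range hf).isClosed
    fun g => ?_).resolve_left (Set.range_nonempty f).ne_empty
  rintro _ ⟨_, ⟨x, rfl⟩, rfl⟩
  exact ⟨g • x, hsmul g x⟩

/-- Clopen subsets of a minimal flow are determined by their return times along one orbit. -/
theorem eq_of_isClopen_of_smul_mem_iff {X : Type*} [TopologicalSpace X] [MulAction G X]
    [MulAction.IsMinimal G X] {U V : Set X} (hU : IsClopen U) (hV : IsClopen V) (x : X)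
    (h : ∀ g : G, g • x ∈ U ↔ g • x ∈ V) : U = V := by
  by_contra hne
  obtain ⟨g, ⟨hgU, hgV⟩ | ⟨hgV, hgU⟩⟩ := ((hU.diff hV).union (hV.diff hU)).isOpen.exists_smul_mem
    G x (Set.symmDiff_nonempty.2 hne)
  · exact hgV ((h g).1 hgU)
  · exact hgU ((h g).2 hgV)

namespace IsMinimalInvariant

variable {M : Set (Ultrafilter G)} (hM : IsMinimalInvariant M)
include hM

/-- The image of `M` in the Stone space is nonempty, closed and invariant, and the Stone space is
minimal. -/
theorem exists_restrict_eq (𝒜 : SyndeticAlgebra G) (u : 𝒜.StoneSpace) :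
    ∃ p ∈ M, restrict 𝒜.toBooleanSubalgebra p = u := by
  have key : restrict 𝒜.toBooleanSubalgebra '' M = Set.univ := by
    refine (eq_empty_or_univ_of_smul_invariant_closed G
      (hM.isClosed.isCompact.image (continuous_restrict _)).isClosed
      fun g => ?_).resolve_left (hM.nonempty.image _).ne_empty
    rintro _ ⟨_, ⟨q, hq, rfl⟩, rfl⟩
    exact ⟨_, hM.translate_mem g q hq, 𝒜.restrict_translate g q⟩
  exact key.superset (Set.mem_univ u)

end IsMinimalInvariant

/-! ### Algebras of return sets -/

section ReturnAlgebra

variable [TopologicalSpace G] [IsTopologicalGroup G] {N : Set (OpenSubgroup G)}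
  (hN : (𝓝 (1 : G)).HasBasis (fun V : OpenSubgroup G => V ∈ N) (fun V => (V : Set G)))
  {M : Set (Ultrafilter G)} (hM : IsMinimalInvariant M)

/-- The syndetic algebra of the return sets of a point of a minimal set to elements of `L`. -/
def returnAlgebra {p : Ultrafilter G} (hp : p ∈ M) : SyndeticAlgebra G where
  carrier := returnSet p '' (algebraL N hN)
  supClosed' := by
    rintro _ ⟨A, hA, rfl⟩ _ ⟨B, hB, rfl⟩
    exact ⟨A ∪ B, BooleanSubalgebra.sup_mem hA hB, returnSet_union p A B⟩
  infClosed' := by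
    rintro _ ⟨A, hA, rfl⟩ _ ⟨B, hB, rfl⟩
    exact ⟨A ∩ B, BooleanSubalgebra.inf_mem hA hB, returnSet_inter p A B⟩
  compl_mem' := by
    rintro _ ⟨A, hA, rfl⟩
    exact ⟨Aᶜ, BooleanSubalgebra.compl_mem hA, returnSet_compl p A⟩
  bot_mem' := ⟨∅, BooleanSubalgebra.bot_mem, returnSet_empty p⟩
  smul_mem' := by
    rintro g _ ⟨A, hA, rfl⟩
    exact ⟨g • A, smul_mem_algebraL hN hA g, returnSet_smul p g A⟩
  syndetic' := by
    rintro _ ⟨A, hA, rfl⟩ hne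
    exact hM.isSyndetic_returnSet hp hne

theorem mem_returnAlgebra {p : Ultrafilter G} {hp : p ∈ M} {S : Set G} :
    S ∈ (returnAlgebra hN hM hp).toBooleanSubalgebra ↔ ∃ A ∈ algebraL N hN, returnSet p A = S :=
  Iff.rfl

theorem returnAlgebra_le {p : Ultrafilter G} (hp : p ∈ M) :
    (returnAlgebra hN hM hp).toBooleanSubalgebra ≤ algebraL N hN := by
  rintro _ ⟨A, hA, rfl⟩
  exact returnSet_mem_algebraL hN hA p

theorem SyndeticAlgebra.IsMaximalIn.eq_returnAlgebra {𝒜 : SyndeticAlgebra G}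
    (h𝒜 : 𝒜.IsMaximalIn (algebraL N hN)) {p : Ultrafilter G} (hp : p ∈ M)
    (hle : ∀ A ∈ 𝒜.toBooleanSubalgebra, ∃ B ∈ 𝒜.toBooleanSubalgebra, returnSet p B = A) :
    𝒜 = returnAlgebra hN hM hp := by
  refine h𝒜.eq_of_le (returnAlgebra_le hN hM hp) fun A hA => ?_
  obtain ⟨B, hB, h⟩ := hle A hA
  exact ⟨B, h𝒜.prop hB, h⟩

include hM in
theorem SyndeticAlgebra.IsMaximalIn.exists_eq_returnAlgebra {𝒜 : SyndeticAlgebra G}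
    (h𝒜 : 𝒜.IsMaximalIn (algebraL N hN)) :
    ∃ (p : Ultrafilter G) (hp : p ∈ M), 𝒜 = returnAlgebra hN hM hp := by
  -- The trace of the principal ultrafilter at `1` is the point whose return times to each `A` in
  -- `𝒜` are `A` itself.
  obtain ⟨p, hp, h⟩ := hM.exists_restrict_eq 𝒜 (restrict _ (pure 1))
  refine ⟨p, hp, h𝒜.eq_returnAlgebra hN hM hp fun A hA => ⟨A, hA, ?_⟩⟩
  ext g
  rw [← SyndeticAlgebra.mem_smul_restrict (A := ⟨A, hA⟩), h,
    SyndeticAlgebra.mem_smul_restrict_pure_one]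

/-- Both algebras are quotients of `L` by the same ideal; `hf` below says that the map does not
depend on the chosen representatives. -/
theorem returnAlgebra_isomorphic {p q : Ultrafilter G} (hp : p ∈ M) (hq : q ∈ M) :
    (returnAlgebra hN hM hp).Isomorphic (returnAlgebra hN hM hq) := by
  choose a ha hpa using fun S : (returnAlgebra hN hM hp).toBooleanSubalgebra =>
    (mem_returnAlgebra hN hM).1 S.2
  let f : (returnAlgebra hN hM hp).toBooleanSubalgebra →
    (returnAlgebra hN hM hq).toBooleanSubalgebra := fun S => ⟨returnSet q (a S), a S, ha S, rfl⟩
  have hle : ∀ S T, f S ≤ f T ↔ S ≤ T := fun S T => by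
    change returnSet q (a S) ⊆ returnSet q (a T) ↔ (S : Set G) ⊆ T
    rw [← hM.returnSet_subset_iff hp hq, hpa, hpa]
  have hf : ∀ (A : Set G) (S : (returnAlgebra hN hM hp).toBooleanSubalgebra),
      returnSet p A = S → (f S : Set G) = returnSet q A := fun A S h => by
    rw [← hpa S] at h
    exact ((hM.returnSet_subset_iff hp hq _ _).1 h.symm.subset).antisymm
      ((hM.returnSet_subset_iff hp hq _ _).1 h.subset)
  have hsurj : Function.Surjective f := by
    rintro ⟨_, A, hA, rfl⟩
    exact ⟨⟨returnSet p A, A, hA, rfl⟩, Subtype.ext (hf A _ rfl)⟩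
  refine ⟨RelIso.ofSurjective (OrderEmbedding.ofMapLEIff f hle) hsurj, fun g S => Subtype.ext ?_⟩
  change (f (g • S) : Set G) = g • (f S : Set G)
  rw [hf (g • a S), returnSet_smul]
  rw [returnSet_smul, hpa, SyndeticAlgebra.coe_smul]

end ReturnAlgebra

/-! ### Universality -/

section Universal

theorem tendsto_extend {α X : Type*} [TopologicalSpace X] [CompactSpace X] [T2Space X] (f : α → X)
    (q : Ultrafilter α) : Tendsto f q (𝓝 (Ultrafilter.extend f q)) :=
  ultrafilter_extend_eq_iff.1 rfl

variable [TopologicalSpace G] {X : Type*} [TopologicalSpace X] [MulAction G X]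
  [CompactSpace X] [T2Space X] [ContinuousSMul G X]

theorem extend_smul_translate (x : X) (g : G) (q : Ultrafilter G) :
    Ultrafilter.extend (fun h : G => h • x) (translate g q)
      = g • Ultrafilter.extend (fun h : G => h • x) q := by
  refine ultrafilter_extend_eq_iff.2 ?_
  have h := ((continuous_const_smul g).tendsto _).comp (tendsto_extend (fun h : G => h • x) q)
  have hcomp : (fun h : G => h • x) ∘ (g • ·) = (g • ·) ∘ fun h : G => h • x :=
    funext fun h => by simp [mul_smul]
  rw [translate, Ultrafilter.map_map, hcomp]
  exact h

variable {N : Set (OpenSubgroup G)}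
  (hN : (𝓝 (1 : G)).HasBasis (fun V : OpenSubgroup G => V ∈ N) (fun V => (V : Set G)))

include hN in
/-- If an algebra contains the return sets of `p` to elements of `L`, then the limits of the orbit
map of a point of the form `lim_{k → p} k • x₀` only depend on the traces on the algebra. -/
theorem extend_smul_eq_of_restrict_eq {B : BooleanSubalgebra (Set G)} {p : Ultrafilter G}
    (hB : ∀ A ∈ algebraL N hN, returnSet p A ∈ B) (x₀ : X) {q q' : Ultrafilter G}
    (hqq' : restrict B q = restrict B q') :
    Ultrafilter.extend (fun h : G => h • Ultrafilter.extend (fun k : G => k • x₀) p) q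
      = Ultrafilter.extend (fun h : G => h • Ultrafilter.extend (fun k : G => k • x₀) p) q' := by
  set y := Ultrafilter.extend (fun k : G => k • x₀) p
  have hy : Tendsto (fun k : G => k • x₀) p (𝓝 y) := tendsto_extend _ p
  have hlim : ∀ h : G, Tendsto (fun k : G => h • k • x₀) p (𝓝 (h • y)) := fun h =>
    ((continuous_const_smul h).tendsto y).comp hy
  set x := Ultrafilter.extend (fun h : G => h • y) q with hx
  set x' := Ultrafilter.extend (fun h : G => h • y) q' with hx'
  by_contra hne
  obtain ⟨W, W', hW, hW', hxW, hxW', hdisj⟩ := t2_separation hne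
  have hcont : Tendsto (fun a : G × X => a.1 • a.2) (𝓝 1 ×ˢ 𝓝 x) (𝓝 x) := by
    have := (continuous_smul (M := G) (X := X)).tendsto (1, x)
    rwa [nhds_prod_eq, one_smul] at this
  obtain ⟨P, hP, Q, hQ, hPQ⟩ := mem_prod_iff.1 (hcont (hW.mem_nhds hxW))
  obtain ⟨V, hV, hVP⟩ := hN.mem_iff.1 hP
  -- The set of `k` with `k • x₀ ∈ interior Q` need not lie in `L`. Multiplying by `V` puts it
  -- there, and `hPQ` still keeps the corresponding orbit points in `W`.
  have hD : (V : Set G) * {k | k • x₀ ∈ interior Q} ∈ algebraL N hN := ⟨V, hV, _, rfl⟩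
  have hDW : ∀ k ∈ (V : Set G) * {k | k • x₀ ∈ interior Q}, k • x₀ ∈ W := by
    rintro _ ⟨v, hv, k, hk, rfl⟩
    have : v • k • x₀ ∈ W := hPQ (show (v, k • x₀) ∈ P ×ˢ Q from ⟨hVP hv, interior_subset hk⟩)
    simpa [mul_smul] using this
  set D := (V : Set G) * {k | k • x₀ ∈ interior Q}
  have hq : returnSet p D ∈ q := by
    filter_upwards [tendsto_extend (fun h : G => h • y) q
      (isOpen_interior.mem_nhds (mem_interior_iff_mem_nhds.2 hQ))] with h hh
    rw [mem_returnSet]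
    filter_upwards [hlim h (isOpen_interior.mem_nhds hh)] with k hk
    rw [Set.mem_inv_smul_set_iff]
    refine ⟨1, V.one_mem, h * k, ?_, one_mul _⟩
    simpa [mul_smul] using hk
  have hq' : returnSet p D ∈ q' := by
    have : (⟨returnSet p D, hB D hD⟩ : B) ∈ (restrict B q).carrier := hq
    rw [hqq'] at this
    exact this
  -- Choosing `h` along `q'` and then `k` along `p` puts `(h * k) • x₀` in both `W` and `W'`.
  obtain ⟨h, hhD, hh⟩ := q'.nonempty_of_mem (inter_mem hq'
    (tendsto_extend (fun h : G => h • y) q' (hW'.mem_nhds hxW')))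
  obtain ⟨k, hkD, hk⟩ := p.nonempty_of_mem (inter_mem hhD (hlim h (hW'.mem_nhds hh)))
  rw [Set.mem_inv_smul_set_iff] at hkD
  refine Set.disjoint_left.1 hdisj (hDW _ hkD) ?_
  simpa [mul_smul] using hk

include hN in
theorem SyndeticAlgebra.exists_continuous_equivariant {𝒜 : SyndeticAlgebra G} {p : Ultrafilter G}
    (h𝒜 : ∀ A ∈ algebraL N hN, returnSet p A ∈ 𝒜.toBooleanSubalgebra) (x₀ : X) :
    ∃ φ : 𝒜.StoneSpace →[G] X, Continuous φ := by
  let π : Ultrafilter G → X :=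
    Ultrafilter.extend (fun h : G => h • Ultrafilter.extend (fun k : G => k • x₀) p)
  have hsurj := restrict_surjective 𝒜.toBooleanSubalgebra
  let f : 𝒜.StoneSpace → X := fun u => π (Function.surjInv hsurj u)
  have hf : ∀ q, f (restrict _ q) = π q := fun q =>
    extend_smul_eq_of_restrict_eq hN h𝒜 x₀ (Function.surjInv_eq hsurj _)
  refine ⟨⟨f, fun g u => ?_⟩, ?_⟩
  · obtain ⟨q, rfl⟩ := hsurj u
    rw [← 𝒜.restrict_translate, hf, hf]
    exact extend_smul_translate _ g q
  · refine (isQuotientMap_restrict 𝒜.toBooleanSubalgebra).continuous_iff.2 ?_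
    exact (continuous_ultrafilter_extend _).congr fun q => (hf q).symm

end Universal

/-! ### Maximal syndetic algebras -/

section Maximal

namespace SyndeticAlgebra

/-- The syndetic algebra consisting of the empty set and the whole group. -/
instance : Bot (SyndeticAlgebra G) where
  bot :=
    { toBooleanSubalgebra := ⊥
      smul_mem' := by
        rintro g A hA
        rcases BooleanSubalgebra.mem_bot.1 hA with rfl | rfl
        · exact BooleanSubalgebra.mem_bot.2 (Or.inl Set.smul_set_empty)
        · exact BooleanSubalgebra.mem_bot.2 (Or.inr Set.smul_set_univ)
      syndetic' := by
        rintro A hA hne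
        rcases BooleanSubalgebra.mem_bot.1 hA with rfl | rfl
        · exact (Set.not_nonempty_empty hne).elim
        · exact ⟨{1}, by simp⟩ }

/-- The union of a nonempty chain of syndetic algebras. -/
def chainUnion (c : Set (SyndeticAlgebra G)) (hc : IsChain (· ≤ ·) c) (hne : c.Nonempty) :
    SyndeticAlgebra G where
  carrier := ⋃ 𝒜 ∈ c, 𝒜.carrier
  supClosed' := by
    intro A hA B hB
    obtain ⟨𝒜, h𝒜, hA⟩ := Set.mem_iUnion₂.1 hA
    obtain ⟨ℬ, hℬ, hB⟩ := Set.mem_iUnion₂.1 hB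
    obtain ⟨𝒞, h𝒞, h, h'⟩ := hc.directedOn 𝒜 h𝒜 ℬ hℬ
    exact Set.mem_iUnion₂.2 ⟨𝒞, h𝒞, 𝒞.supClosed' (h hA) (h' hB)⟩
  infClosed' := by
    intro A hA B hB
    obtain ⟨𝒜, h𝒜, hA⟩ := Set.mem_iUnion₂.1 hA
    obtain ⟨ℬ, hℬ, hB⟩ := Set.mem_iUnion₂.1 hB
    obtain ⟨𝒞, h𝒞, h, h'⟩ := hc.directedOn 𝒜 h𝒜 ℬ hℬ
    exact Set.mem_iUnion₂.2 ⟨𝒞, h𝒞, 𝒞.infClosed' (h hA) (h' hB)⟩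
  compl_mem' hA := by
    obtain ⟨𝒜, h𝒜, hA⟩ := Set.mem_iUnion₂.1 hA
    exact Set.mem_iUnion₂.2 ⟨𝒜, h𝒜, 𝒜.compl_mem' hA⟩
  bot_mem' := Set.mem_iUnion₂.2 ⟨hne.some, hne.some_mem, hne.some.bot_mem'⟩
  smul_mem' g A hA := by
    obtain ⟨𝒜, h𝒜, hA⟩ := Set.mem_iUnion₂.1 hA
    exact Set.mem_iUnion₂.2 ⟨𝒜, h𝒜, 𝒜.smul_mem' g A hA⟩
  syndetic' A hA := by
    obtain ⟨𝒜, h𝒜, hA⟩ := Set.mem_iUnion₂.1 hA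
    exact 𝒜.syndetic' A hA

theorem exists_isMaximalIn (L : BooleanSubalgebra (Set G)) :
    ∃ 𝒜 : SyndeticAlgebra G, 𝒜.IsMaximalIn L := by
  have hchain : ∀ c ⊆ {ℬ : SyndeticAlgebra G | ℬ.toBooleanSubalgebra ≤ L}, IsChain (· ≤ ·) c →
      ∀ 𝒜 ∈ c, ∃ ub ∈ {ℬ : SyndeticAlgebra G | ℬ.toBooleanSubalgebra ≤ L}, ∀ ℬ ∈ c, ℬ ≤ ub := by
    intro c hcL hc 𝒜 h𝒜
    refine ⟨chainUnion c hc ⟨𝒜, h𝒜⟩, fun A hA => ?_, fun ℬ hℬ A hA =>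
      Set.mem_iUnion₂.2 ⟨ℬ, hℬ, hA⟩⟩
    obtain ⟨ℬ, hℬ, hA⟩ := Set.mem_iUnion₂.1 hA
    exact hcL hℬ hA
  obtain ⟨𝒜, -, h𝒜⟩ := zorn_le_nonempty₀ _ hchain ⊥
    (show (⊥ : BooleanSubalgebra (Set G)) ≤ L from bot_le)
  exact ⟨𝒜, h𝒜⟩

variable [TopologicalSpace G] [IsTopologicalGroup G] {N : Set (OpenSubgroup G)}
  {hN : (𝓝 (1 : G)).HasBasis (fun V : OpenSubgroup G => V ∈ N) (fun V => (V : Set G))}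
  {𝒜 ℬ : SyndeticAlgebra G}

theorem IsMaximalIn.isUniversalMinimalFlow {G : Type u} [Group G] [TopologicalSpace G]
    [IsTopologicalGroup G] {N : Set (OpenSubgroup G)}
    {hN : (𝓝 (1 : G)).HasBasis (fun V : OpenSubgroup G => V ∈ N) (fun V => (V : Set G))}
    {𝒜 : SyndeticAlgebra G} (h𝒜 : 𝒜.IsMaximalIn (algebraL N hN)) :
    IsUniversalMinimalFlow.{u, u, v} G 𝒜.StoneSpace where
  toIsMinimalFlow := isMinimalFlow hN h𝒜.prop
  universal X _ _ hX := by
    obtain ⟨M, hM⟩ := exists_isMinimalInvariant G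
    obtain ⟨p, hp, rfl⟩ := h𝒜.exists_eq_returnAlgebra hN hM
    have := hX.compact
    have := hX.hausdorff
    have := hX.continuous_smul
    have := hX.minimal
    obtain ⟨x₀⟩ := hX.nonempty
    obtain ⟨φ, hφ⟩ := exists_continuous_equivariant (𝒜 := returnAlgebra hN hM hp) (p := p) hN
      (fun A hA => ⟨A, hA, rfl⟩) x₀
    have := (isMinimalFlow hN h𝒜.prop).nonempty
    exact ⟨φ, hφ, surjective_of_equivariant hφ (map_smul φ)⟩

theorem IsMaximalIn.isomorphic (h𝒜 : 𝒜.IsMaximalIn (algebraL N hN))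
    (hℬ : ℬ.IsMaximalIn (algebraL N hN)) : 𝒜.Isomorphic ℬ := by
  obtain ⟨M, hM⟩ := exists_isMinimalInvariant G
  obtain ⟨p, hp, rfl⟩ := h𝒜.exists_eq_returnAlgebra hN hM
  obtain ⟨q, hq, rfl⟩ := hℬ.exists_eq_returnAlgebra hN hM
  exact returnAlgebra_isomorphic hN hM hp hq

/-- Endomorphisms of the Stone space of a maximal syndetic subalgebra are injective. -/
theorem IsMaximalIn.injective_of_equivariant (h𝒜 : 𝒜.IsMaximalIn (algebraL N hN))
    {θ : 𝒜.StoneSpace → 𝒜.StoneSpace} (hθ : Continuous θ)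
    (hsmul : ∀ (g : G) (u : 𝒜.StoneSpace), θ (g • u) = g • θ u) : Function.Injective θ := by
  have hne := (isMinimalFlow hN h𝒜.prop).nonempty
  obtain ⟨M, hM⟩ := exists_isMinimalInvariant G
  -- A preimage of the base point is represented by some `q ∈ M`. If `θ` pulls the clopen set of `A`
  -- back to that of `B`, then `A = returnSet q B`, which forces `𝒜` to be the return algebra of
  -- `q`.
  obtain ⟨u₀, hu₀⟩ := surjective_of_equivariant hθ hsmul (restrict _ (pure 1))
  obtain ⟨q, hq, rfl⟩ := hM.exists_restrict_eq 𝒜 u₀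
  have hpre : ∀ A : 𝒜.toBooleanSubalgebra, ∃ B : 𝒜.toBooleanSubalgebra,
      θ ⁻¹' {u | A ∈ u.carrier} = {u | B ∈ u.carrier} := fun A =>
    BoolUltrafilter.exists_eq_setOf_mem ((BoolUltrafilter.isClopen_setOf_mem A).preimage hθ)
  have hret : ∀ (A : 𝒜.toBooleanSubalgebra) (g : G),
      g • restrict 𝒜.toBooleanSubalgebra q ∈ θ ⁻¹' {u | A ∈ u.carrier} ↔ g ∈ (A : Set G) :=
    fun A g => by
      rw [Set.mem_preimage, hsmul, hu₀]
      exact mem_smul_restrict_pure_one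
  have heq : 𝒜 = returnAlgebra hN hM hq := by
    refine h𝒜.eq_returnAlgebra hN hM hq fun A hA => ?_
    obtain ⟨B, hB⟩ := hpre ⟨A, hA⟩
    refine ⟨B, B.2, ?_⟩
    ext g
    rw [← hret ⟨A, hA⟩, hB]
    exact mem_smul_restrict.symm
  -- Conversely, `A = returnSet q B` lies in `𝒜`, and the preimage of its clopen set has the same
  -- return times from `q` as the clopen set of `B`. So every basic clopen set is a preimage under
  -- `θ`, and these separate points.
  have hsurj : ∀ B : 𝒜.toBooleanSubalgebra, ∃ A : 𝒜.toBooleanSubalgebra,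
      θ ⁻¹' {u | A ∈ u.carrier} = {u | B ∈ u.carrier} := fun B => by
    have hA : returnSet q (B : Set G) ∈ 𝒜.toBooleanSubalgebra := by
      have : returnSet q (B : Set G) ∈ (returnAlgebra hN hM hq).toBooleanSubalgebra :=
        ⟨B, h𝒜.prop B.2, rfl⟩
      rwa [← heq] at this
    refine ⟨⟨_, hA⟩, eq_of_isClopen_of_smul_mem_iff
      ((BoolUltrafilter.isClopen_setOf_mem _).preimage hθ) (BoolUltrafilter.isClopen_setOf_mem B)
      (restrict 𝒜.toBooleanSubalgebra q) fun g => (hret _ g).trans mem_smul_restrict.symm⟩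
  intro u v huv
  by_contra hne
  obtain ⟨B, hBu, hBv⟩ := BoolUltrafilter.exists_mem_notMem hne
  obtain ⟨A, hA⟩ := hsurj B
  have h : u ∈ θ ⁻¹' {u | A ∈ u.carrier} := hA.superset hBu
  rw [Set.mem_preimage, huv] at h
  exact hBv (hA.subset h)

theorem IsMaximalIn.flowIso {G : Type u} [Group G] [TopologicalSpace G]
    [IsTopologicalGroup G] {N : Set (OpenSubgroup G)}
    {hN : (𝓝 (1 : G)).HasBasis (fun V : OpenSubgroup G => V ∈ N) (fun V => (V : Set G))}
    {𝒜 : SyndeticAlgebra G} (h𝒜 : 𝒜.IsMaximalIn (algebraL N hN)) {M : Type v}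
    [TopologicalSpace M] [MulAction G M] (hM : IsUniversalMinimalFlow.{u, v, u} G M) :
    FlowIso G M 𝒜.StoneSpace := by
  obtain ⟨ψ, hψ, -⟩ := hM.universal 𝒜.StoneSpace (isMinimalFlow hN h𝒜.prop)
  obtain ⟨φ, hφ, hsurj⟩ := h𝒜.isUniversalMinimalFlow.universal M hM.toIsMinimalFlow
  -- `ψ ∘ φ` is an equivariant self-map of the Stone space, so coalescence makes it injective, and
  -- `φ` with it.
  have hinj : Function.Injective φ := Function.Injective.of_comp (f := ψ)
    (h𝒜.injective_of_equivariant (hψ.comp hφ) fun g u => by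
      simp only [Function.comp_apply, map_smul])
  have := hM.hausdorff
  let e := (hφ.isClosedEmbedding hinj).isEmbedding.toHomeomorphOfSurjective hsurj
  refine ⟨e.symm, fun g x => ?_⟩
  rw [Homeomorph.symm_apply_eq]
  change g • x = φ (g • e.symm x)
  rw [map_smul]
  exact congrArg (g • ·) (e.apply_symm_apply x).symm

end SyndeticAlgebra

end Maximal

end FlowStone

theorem mainTheorem10 {G : Type u} [Group G] [TopologicalSpace G] [IsTopologicalGroup G]
    (N : Set (OpenSubgroup G))
    (hN : (𝓝 (1 : G)).HasBasis (fun V : OpenSubgroup G => V ∈ N) (fun V => (V : Set G))) :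
    -- maximal syndetic subalgebras of `L` exist
    (∃ 𝒜 : FlowStone.SyndeticAlgebra G, 𝒜.IsMaximalIn (FlowStone.algebraL N hN)) ∧
    -- the Stone space of any of them is a universal minimal flow
    (∀ 𝒜 : FlowStone.SyndeticAlgebra G, 𝒜.IsMaximalIn (FlowStone.algebraL N hN) →
      FlowStone.IsUniversalMinimalFlow.{u, u, v} G 𝒜.StoneSpace) ∧
    -- any two of them are isomorphic
    (∀ 𝒜 ℬ : FlowStone.SyndeticAlgebra G, 𝒜.IsMaximalIn (FlowStone.algebraL N hN) →
      ℬ.IsMaximalIn (FlowStone.algebraL N hN) → 𝒜.Isomorphic ℬ) ∧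
    -- any universal minimal flow is isomorphic to these Stone spaces, and is totally disconnected
    (∀ (M : Type v) [TopologicalSpace M] [MulAction G M],
      FlowStone.IsUniversalMinimalFlow.{u, v, u} G M →
        (∀ 𝒜 : FlowStone.SyndeticAlgebra G, 𝒜.IsMaximalIn (FlowStone.algebraL N hN) →
          FlowStone.FlowIso G M 𝒜.StoneSpace) ∧
        TotallyDisconnectedSpace M) := by
  refine ⟨FlowStone.SyndeticAlgebra.exists_isMaximalIn _, fun 𝒜 h𝒜 => h𝒜.isUniversalMinimalFlow,
    fun 𝒜 ℬ h𝒜 hℬ => h𝒜.isomorphic hℬ, fun M _ _ hM => ⟨fun 𝒜 h𝒜 => h𝒜.flowIso hM, ?_⟩⟩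
  obtain ⟨𝒜, h𝒜⟩ := FlowStone.SyndeticAlgebra.exists_isMaximalIn (FlowStone.algebraL N hN)
  obtain ⟨e, -⟩ := h𝒜.flowIso hM
  exact e.symm.totallyDisconnectedSpace
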